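/- Let $d \ge 3$ be an odd integer, $X = \{1, \ldots, d\}$, and let $T$ be the $d$-regular rooted tree with vertex set the free monoid $X^*$, rooted at the empty word, in which the children of a vertex $u$ are the words $ux$, $x \in X$. Let $\mathrm{Aut}(T)$ be the group of graph automorphisms of $T$ that fix the root. For $g \in \mathrm{Aut}(T)$ and $u \in X^*$, the section $g|_u \in \mathrm{Aut}(T)$ is determined by $g(uv) = g(u)\, g|_u(v)$ for all $v \in X^*$. Let $G_d \le \mathrm{Aut}(T)$ be the subgroup generated by $a_1, \ldots, a_d$, where (with indices and letters read modulo $d$) $a_i$ acts on $X$ as the transposition $(i \;\, i+1)$ and has the sections $a_i|_i = a_i$, $a_i|_{i+1} = a_{i+1}$, and $a_i|_x = e$ for $x \in X \setminus \{i, i+1\}$. For $G \le \mathrm{Aut}(T)$, $k \ge 0$ and $u \in X^*$, let $\mathrm{St}_G(u)$ be the stabilizer of $u$ in $G$, let $\mathrm{St}_G(\widehat{k}) = \bigcap_{u \in X^k} \mathrm{St}_G(u)$, and let $\pi_u$ be the homomorphism $g \mapsto g|_u$ on $\mathrm{St}_G(u)$. The group $G$ is called very strongly fractal if it is self-similar (i.e.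 $g|_u \in G$ for all $g \in G$, $u \in X^*$), acts transitively on $X^k$ for every $k$, and satisfies $\pi_x(\mathrm{St}_G(\widehat{k+1})) = \mathrm{St}_G(\widehat{k})$ for all $k \ge 0$ and $x \in X$. Then, for all $k \ge 0$ and $x \in X$, $$\pi_x\bigl(\mathrm{St}_{G_d}(\widehat{k+1})\bigr) = \mathrm{St}_{G_d}(\widehat{k}),$$ and $G_d$ is very strongly fractal. -/

import Mathlib

namespace RootedTree

variable {X : Type*}

/-- The regular rooted tree over the alphabet `X`: the vertices are the words over `X`, the root
is the empty word, and the children of `u` are the words `u ++ [x]` for `x : X`. -/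
def tree (X : Type*) : SimpleGraph (List X) where
  Adj u v := (∃ x, v = u ++ [x]) ∨ (∃ x, u = v ++ [x])
  symm := ⟨fun _ _ h => h.symm⟩
  loopless := ⟨by
    intro u h
    rcases h with ⟨x, h⟩ | ⟨x, h⟩ <;> simpa using congrArg List.length h⟩

/-- `Aut(T)`: the graph automorphisms of the tree that preserve the root, as a subgroup of the
group of all graph automorphisms. The product is composition, `(g * h) u = g (h u)`; the subgroups
of this group are the same sets as for the opposite order of composition. -/
def rootedAut (X : Type*) : Subgroup (tree X ≃g tree X) where
  carrier := {g | g [] = []}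
  one_mem' := rfl
  mul_mem' := by
    intro g h hg hh
    have hg' : g [] = [] := hg
    have hh' : h [] = [] := hh
    change g (h []) = []
    rw [hh', hg']
  inv_mem' := by
    intro g hg
    have hg' : g [] = [] := hg
    change g.symm [] = []
    exact g.symm_apply_eq.2 hg'.symm

/-- The group `Aut(T)` of automorphisms of the rooted tree over `X`. -/
abbrev TreeAut (X : Type*) : Type _ := rootedAut X

/-- The value of a tree automorphism at a vertex. -/
def app (g : TreeAut X) (u : List X) : List X := g.1 u

theorem app_one (u : List X) : app (1 : TreeAut X) u = u := rfl

theorem app_mul (g h : TreeAut X) (u : List X) : app (g * h) u = app g (app h u) := rfl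

theorem app_nil (g : TreeAut X) : app g [] = [] := g.2

theorem app_inv_app (g : TreeAut X) (u : List X) : app g⁻¹ (app g u) = u := by
  rw [← app_mul, inv_mul_cancel, app_one]

theorem app_app_inv (g : TreeAut X) (u : List X) : app g (app g⁻¹ u) = u := by
  rw [← app_mul, mul_inv_cancel, app_one]

theorem app_injective (g : TreeAut X) : Function.Injective (app g) :=
  g.1.injective

theorem ext_app {g h : TreeAut X} (H : ∀ u, app g u = app h u) : g = h :=
  Subtype.ext (RelIso.ext H)

theorem app_concat (g : TreeAut X) (u : List X) (x : X) :
    ∃ y, app g (u ++ [x]) = app g u ++ [y] := by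
  induction u using List.reverseRecOn generalizing x with
  | nil =>
    have h : (tree X).Adj (app g []) (app g ([] ++ [x])) :=
      g.1.map_rel_iff.2 (Or.inl ⟨x, rfl⟩)
    rcases h with h | ⟨y, h⟩
    · exact h
    · rw [app_nil] at h
      simp at h
  | append_singleton w z ih =>
    have h : (tree X).Adj (app g (w ++ [z])) (app g (w ++ [z] ++ [x])) :=
      g.1.map_rel_iff.2 (Or.inl ⟨x, rfl⟩)
    rcases h with h | ⟨y, h⟩
    · exact h
    · obtain ⟨y', hy'⟩ := ih z
      rw [hy'] at h
      have h1 := app_injective g (List.append_inj_left' h rfl)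
      simpa using congrArg List.length h1

theorem length_app (g : TreeAut X) (u : List X) : (app g u).length = u.length := by
  induction u using List.reverseRecOn with
  | nil => rw [app_nil]
  | append_singleton w z ih =>
    obtain ⟨y, hy⟩ := app_concat g w z
    rw [hy, List.length_append, List.length_append, ih]
    rfl

theorem exists_app_append (g : TreeAut X) (u v : List X) :
    ∃ v', app g (u ++ v) = app g u ++ v' := by
  induction v using List.reverseRecOn with
  | nil => exact ⟨[], by simp⟩
  | append_singleton w z ih =>
    obtain ⟨w', hw⟩ := ih
    obtain ⟨y, hy⟩ := app_concat g (u ++ w) z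
    exact ⟨w' ++ [y], by rw [← List.append_assoc, hy, hw, List.append_assoc]⟩

/-- The word `v'` with `g (u v) = g u v'`. -/
def sectionFun (g : TreeAut X) (u v : List X) : List X := (app g (u ++ v)).drop u.length

/-- `sectionFun g u v` is the word `v'` with `g (u v) = g u v'`. -/
theorem app_append (g : TreeAut X) (u v : List X) :
    app g (u ++ v) = app g u ++ sectionFun g u v := by
  obtain ⟨v', h⟩ := exists_app_append g u v
  rw [sectionFun, h, ← length_app g u, List.drop_left]

theorem sectionFun_mul (g h : TreeAut X) (u v : List X) :
    sectionFun (g * h) u v = sectionFun g (app h u) (sectionFun h u v) := by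
  have h1 := app_append (g * h) u v
  rw [app_mul, app_mul, app_append h, app_append g] at h1
  exact (List.append_cancel_left h1).symm

theorem sectionFun_one (u v : List X) : sectionFun (1 : TreeAut X) u v = v := by
  have h1 := app_append (1 : TreeAut X) u v
  rw [app_one, app_one] at h1
  exact (List.append_cancel_left h1).symm

theorem tree_adj_append (u v w : List X) :
    (tree X).Adj (u ++ v) (u ++ w) ↔ (tree X).Adj v w := by
  simp [tree]

/-- The section `g|_u` of `g` at the vertex `u`: the tree automorphism with
`g (u v) = g u (g|_u v)` for all words `v`. -/
def sec (g : TreeAut X) (u : List X) : TreeAut X :=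
  ⟨{ toFun := sectionFun g u
     invFun := sectionFun g⁻¹ (app g u)
     left_inv := fun v => by rw [← sectionFun_mul, inv_mul_cancel, sectionFun_one]
     right_inv := fun v => by
       have h := sectionFun_mul g g⁻¹ (app g u) v
       rw [mul_inv_cancel, sectionFun_one, app_inv_app] at h
       exact h.symm
     map_rel_iff' := by
       intro v w
       change (tree X).Adj (sectionFun g u v) (sectionFun g u w) ↔ (tree X).Adj v w
       rw [← tree_adj_append (app g u), ← app_append, ← app_append, ← tree_adj_append u v w]
       exact g.1.map_rel_iff },
    by
      change sectionFun g u [] = []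
      rw [sectionFun, List.append_nil, ← length_app g u, List.drop_length]⟩

theorem sec_mul (g h : TreeAut X) (u : List X) :
    sec (g * h) u = sec g (app h u) * sec h u :=
  ext_app (sectionFun_mul g h u)

theorem sec_one (u : List X) : sec (1 : TreeAut X) u = 1 :=
  ext_app (sectionFun_one u)

/-- `St_G(u)`: the stabilizer in `G` of the vertex `u`. -/
def vertexStabilizer (G : Subgroup (TreeAut X)) (u : List X) : Subgroup (TreeAut X) where
  carrier := {g | g ∈ G ∧ app g u = u}
  one_mem' := ⟨G.one_mem, rfl⟩
  mul_mem' := by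
    rintro g h ⟨hg, hgu⟩ ⟨hh, hhu⟩
    exact ⟨G.mul_mem hg hh, by rw [app_mul, hhu, hgu]⟩
  inv_mem' := by
    rintro g ⟨hg, hgu⟩
    exact ⟨G.inv_mem hg, by conv_lhs => rw [← hgu, app_inv_app]⟩

/-- `St_G(k)`: the stabilizer in `G` of the `k`-th level, the intersection of the stabilizers
of all words of length `k`. -/
def levelStabilizer (G : Subgroup (TreeAut X)) (k : ℕ) : Subgroup (TreeAut X) where
  carrier := {g | g ∈ G ∧ ∀ u : List X, u.length = k → app g u = u}
  one_mem' := ⟨G.one_mem, fun _ _ => rfl⟩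
  mul_mem' := by
    rintro g h ⟨hg, hgu⟩ ⟨hh, hhu⟩
    exact ⟨G.mul_mem hg hh, fun u hu => by rw [app_mul, hhu u hu, hgu u hu]⟩
  inv_mem' := by
    rintro g ⟨hg, hgu⟩
    exact ⟨G.inv_mem hg, fun u hu => by conv_lhs => rw [← hgu u hu, app_inv_app]⟩

/-- An element of the `(k+1)`-st level stabilizer fixes every vertex of the first level. -/
theorem levelStabilizer_succ_le (G : Subgroup (TreeAut X)) (k : ℕ) (x : X) :
    levelStabilizer G (k + 1) ≤ vertexStabilizer G [x] := by
  rintro g ⟨hg, hgu⟩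
  refine ⟨hg, ?_⟩
  have h := hgu ([x] ++ List.replicate k x) (by simp)
  rw [app_append] at h
  exact List.append_inj_left h (length_app g [x])

/-- The homomorphism `π_u : g ↦ g|_u` on the stabilizer of the vertex `u`. -/
def proj (G : Subgroup (TreeAut X)) (u : List X) : vertexStabilizer G u →* TreeAut X where
  toFun g := sec g.1 u
  map_one' := sec_one u
  map_mul' g h := by
    change sec (g.1 * h.1) u = sec g.1 u * sec h.1 u
    rw [sec_mul, h.2.2]

/-- The image `π_x(St_G(k))` for a letter `x`; for `1 ≤ k` the group `St_G(k)` is contained in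
`St_G(x)`, see `levelStabilizer_succ_le`. -/
def projLevelStabilizer (G : Subgroup (TreeAut X)) (x : X) (k : ℕ) : Subgroup (TreeAut X) :=
  ((levelStabilizer G k).subgroupOf (vertexStabilizer G [x])).map (proj G [x])

/-- `G` is self-similar: it contains all sections of its elements. -/
def IsSelfSimilar (G : Subgroup (TreeAut X)) : Prop :=
  ∀ g ∈ G, ∀ u : List X, sec g u ∈ G

/-- `G` acts transitively on each level of the tree. -/
def IsLevelTransitive (G : Subgroup (TreeAut X)) : Prop :=
  ∀ u v : List X, u.length = v.length → ∃ g ∈ G, app g u = v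

/-- `G` is very strongly fractal: it is self-similar, transitive on each level, and
`π_x(St_G(k+1)) = St_G(k)` for all `k ≥ 0` and all letters `x`. -/
def IsVeryStronglyFractal (G : Subgroup (TreeAut X)) : Prop :=
  IsSelfSimilar G ∧ IsLevelTransitive G ∧
    ∀ (k : ℕ) (x : X), projLevelStabilizer G x (k + 1) = levelStabilizer G k

end RootedTree

namespace GroupGd

open RootedTree

variable {d : ℕ}

/-- The action on words of the generator `a_i`, with alphabet `Fin d` and `finRotate d` for the
cyclic successor `i ↦ i + 1` modulo `d`: it swaps the letters `i` and `i + 1`, and its sections are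
`a_i` at `i`, `a_{i+1}` at `i + 1`, and trivial at every other letter. -/
def genFun : Fin d → List (Fin d) → List (Fin d)
  | _, [] => []
  | i, x :: v =>
    Equiv.swap i (finRotate d i) x ::
      (if x = i then genFun i v
        else if x = finRotate d i then genFun (finRotate d i) v else v)

/-- The inverse of `genFun i`. -/
def genInv : Fin d → List (Fin d) → List (Fin d)
  | _, [] => []
  | i, y :: v =>
    Equiv.swap i (finRotate d i) y ::
      (if Equiv.swap i (finRotate d i) y = i then genInv i v
        else if Equiv.swap i (finRotate d i) y = finRotate d i then genInv (finRotate d i) v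
          else v)

theorem genInv_genFun (i : Fin d) (v : List (Fin d)) : genInv i (genFun i v) = v := by
  induction v generalizing i with
  | nil => rfl
  | cons x v ih =>
    rw [genFun, genInv, Equiv.swap_apply_self]
    split_ifs <;> simp [ih]

theorem genFun_genInv (i : Fin d) (v : List (Fin d)) : genFun i (genInv i v) = v := by
  induction v generalizing i with
  | nil => rfl
  | cons x v ih =>
    rw [genInv, genFun, Equiv.swap_apply_self]
    split_ifs <;> simp [ih]

theorem genFun_concat (i : Fin d) (v : List (Fin d)) (z : Fin d) :
    ∃ y, genFun i (v ++ [z]) = genFun i v ++ [y] := by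
  induction v generalizing i with
  | nil => exact ⟨Equiv.swap i (finRotate d i) z, by simp [genFun]⟩
  | cons x v ih =>
    rw [List.cons_append, genFun, genFun]
    split_ifs
    · obtain ⟨y, hy⟩ := ih i
      exact ⟨y, by rw [hy, List.cons_append]⟩
    · obtain ⟨y, hy⟩ := ih (finRotate d i)
      exact ⟨y, by rw [hy, List.cons_append]⟩
    · exact ⟨z, rfl⟩

theorem genInv_concat (i : Fin d) (v : List (Fin d)) (z : Fin d) :
    ∃ y, genInv i (v ++ [z]) = genInv i v ++ [y] := by
  induction v generalizing i with
  | nil => exact ⟨Equiv.swap i (finRotate d i) z, by simp [genInv]⟩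
  | cons x v ih =>
    rw [List.cons_append, genInv, genInv]
    split_ifs
    · obtain ⟨y, hy⟩ := ih i
      exact ⟨y, by rw [hy, List.cons_append]⟩
    · obtain ⟨y, hy⟩ := ih (finRotate d i)
      exact ⟨y, by rw [hy, List.cons_append]⟩
    · exact ⟨z, rfl⟩

/-- The generator `a_i` of `G_d` as an automorphism of the rooted tree. -/
def gen (i : Fin d) : TreeAut (Fin d) :=
  ⟨{ toFun := genFun i
     invFun := genInv i
     left_inv := genInv_genFun i
     right_inv := genFun_genInv i
     map_rel_iff' := by
       intro u v
       change (tree (Fin d)).Adj (genFun i u) (genFun i v) ↔ (tree (Fin d)).Adj u v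
       constructor
       · rintro (⟨z, h⟩ | ⟨z, h⟩)
         · obtain ⟨y, hy⟩ := genInv_concat i (genFun i u) z
           rw [← h, genInv_genFun, genInv_genFun] at hy
           exact Or.inl ⟨y, hy⟩
         · obtain ⟨y, hy⟩ := genInv_concat i (genFun i v) z
           rw [← h, genInv_genFun, genInv_genFun] at hy
           exact Or.inr ⟨y, hy⟩
       · rintro (⟨z, rfl⟩ | ⟨z, rfl⟩)
         · exact Or.inl (genFun_concat i u z)
         · exact Or.inr (genFun_concat i v z) },
    rfl⟩

/-- The wreath recursion of `a_i`: its action on the letters. -/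
theorem app_gen_singleton (i x : Fin d) :
    app (gen i) [x] = [Equiv.swap i (finRotate d i) x] := by
  change genFun i [x] = _
  simp [genFun]

/-- The wreath recursion of `a_i`: its sections at the letters. -/
theorem sec_gen_singleton (i x : Fin d) :
    sec (gen i) [x] =
      if x = i then gen i else if x = finRotate d i then gen (finRotate d i) else 1 := by
  apply ext_app
  intro v
  change (genFun i (x :: v)).drop 1 = _
  rw [genFun]
  split_ifs <;> rfl

/-- The group `G_d`, generated by `a_i` for `i : Fin d`. -/
def groupG (d : ℕ) : Subgroup (TreeAut (Fin d)) :=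
  Subgroup.closure (Set.range gen)

end GroupGd

/-! Self-similarity gives one inclusion. For the other, given `g` in `St_G(k)`, it suffices to find
an element of `G` that fixes all letters and has sections `g` at `x`, `g⁻¹` at `x + 1` and `1`
elsewhere: all these sections stabilize level `k`, so the element stabilizes level `k + 1`. It
exists for every `g` in `G` (`mulSingle_mul_mulSingle_inv_mem`).

Let `K` be the group of those `k` for which `G` contains the element with section `k` at one letter
and `1` elsewhere. Since `G` moves any letter to any letter with any section in `G`
(`exists_moves_of_mem`, which also gives level transitivity), `K` does not depend on the letter and
is normalized by `G`. The braid commutator of `a_i` and `a_{i+1}` puts `a_i a_{i+2}⁻¹` in `K`; as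
`d` is odd, all `a_i a_j⁻¹` lie in `K`, so `G = K⟨a_p⟩`. This reduces the claim to `g = a_p`. There,
the exchange of `p` and `p + 1` by `a_p` is compared with one obtained by travelling the other way
round the cycle, in `d - 1` steps, an even number. -/

namespace RootedTree

variable {X : Type*}

/-! ### Calculus of letter moves and sections -/

/-- `g` maps the letter `x` to the letter `y`, and its section at `x` is `s`. -/
def Moves (g : TreeAut X) (x y : X) (s : TreeAut X) : Prop :=
  app g [x] = [y] ∧ sec g [x] = s

theorem Moves.mul {g h s t : TreeAut X} {x y z : X} (hg : Moves g y z t) (hh : Moves h x y s) :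
    Moves (g * h) x z (t * s) := by
  refine ⟨?_, ?_⟩
  · rw [app_mul, hh.1, hg.1]
  · rw [sec_mul, hh.1, hg.2, hh.2]

theorem moves_one (x : X) : Moves (1 : TreeAut X) x x 1 :=
  ⟨rfl, sec_one _⟩

theorem Moves.inv {g s : TreeAut X} {x y : X} (hg : Moves g x y s) : Moves g⁻¹ y x s⁻¹ := by
  have h1 : app g⁻¹ [y] = [x] := by rw [← hg.1, app_inv_app]
  refine ⟨h1, ?_⟩
  have h2 := sec_mul g⁻¹ g [x]
  rw [inv_mul_cancel, sec_one, hg.1, hg.2] at h2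
  exact eq_inv_of_mul_eq_one_left h2.symm

theorem Moves.app_cons {g s : TreeAut X} {x y : X} (hg : Moves g x y s) (v : List X) :
    app g (x :: v) = y :: app s v := by
  have h := app_append g [x] v
  rw [hg.1] at h
  rw [← hg.2]
  exact h

theorem Moves.target_unique {g s t : TreeAut X} {x y z : X} (h : Moves g x y s)
    (h' : Moves g x z t) : y = z := by
  simpa using h.1.symm.trans h'.1

theorem Moves.source_unique {g s t : TreeAut X} {x y z : X} (h : Moves g x z s)
    (h' : Moves g y z t) : x = y := by
  simpa using app_injective g (h.1.trans h'.1.symm)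

theorem Moves.sec_unique {g s t : TreeAut X} {x y z : X} (h : Moves g x y s)
    (h' : Moves g x z t) : s = t :=
  h.2.symm.trans h'.2

theorem exists_moves (g : TreeAut X) (x : X) : ∃ y, Moves g x y (sec g [x]) := by
  obtain ⟨y, hy⟩ := app_concat g [] x
  rw [app_nil] at hy
  exact ⟨y, hy, rfl⟩

theorem exists_moves_to (g : TreeAut X) (y : X) : ∃ x s, Moves g x y s := by
  obtain ⟨x, hx⟩ := exists_moves g⁻¹ y
  exact ⟨x, _, inv_inv g ▸ hx.inv⟩

theorem sec_append (g : TreeAut X) (u v : List X) : sec g (u ++ v) = sec (sec g u) v := by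
  refine ext_app fun w => ?_
  have h1 := app_append g (u ++ v) w
  rw [List.append_assoc, app_append g u (v ++ w), app_append g u v] at h1
  have h2 := app_append (sec g u) v w
  change sectionFun g u (v ++ w) = sectionFun g u v ++ _ at h2
  rw [h2, ← List.append_assoc] at h1
  exact (List.append_cancel_left h1).symm

/-! ### Reductions to the first level -/

theorem IsSelfSimilar.of_letters {G : Subgroup (TreeAut X)}
    (h : ∀ g ∈ G, ∀ x, sec g [x] ∈ G) : IsSelfSimilar G := by
  intro g hg u
  induction u generalizing g with
  | nil =>
    have : sec g [] = g := ext_app fun v => by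
      change sectionFun g [] v = _
      simp [sectionFun]
    rwa [this]
  | cons x v ih =>
    rw [← List.singleton_append, sec_append]
    exact ih _ (h g hg x)

theorem sec_closure_mem {S : Set (TreeAut X)}
    (hS : ∀ g ∈ S, ∀ x, sec g [x] ∈ Subgroup.closure S) {g : TreeAut X}
    (hg : g ∈ Subgroup.closure S) (x : X) : sec g [x] ∈ Subgroup.closure S := by
  induction hg using Subgroup.closure_induction generalizing x with
  | mem g hg => exact hS g hg x
  | one => rw [sec_one]; exact one_mem _
  | mul g h _ _ ihg ihh =>
    obtain ⟨y, hy⟩ := exists_moves h x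
    rw [((exists_moves g y).choose_spec.mul hy).2]
    exact mul_mem (ihg y) (ihh x)
  | inv g _ ih =>
    obtain ⟨y, s, hy⟩ := exists_moves_to g x
    rw [hy.inv.2, ← hy.2]
    exact inv_mem (ih y)

/-- If every letter can be moved to every letter by an element of `G` with any prescribed section
in `G`, then `G` is level transitive. -/
theorem IsLevelTransitive.of_letters {G : Subgroup (TreeAut X)}
    (h : ∀ x y, ∀ s ∈ G, ∃ g ∈ G, Moves g x y s) : IsLevelTransitive G := by
  intro u
  induction u with
  | nil =>
    intro v hv
    exact ⟨1, one_mem _, (List.length_eq_zero_iff.1 hv.symm).symm⟩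
  | cons x u ih =>
    rintro (_ | ⟨y, v⟩) hv
    · simp at hv
    · obtain ⟨s, hs, hsu⟩ := ih v (by simpa using hv)
      obtain ⟨g, hg, hgs⟩ := h x y s hs
      exact ⟨g, hg, by rw [hgs.app_cons, hsu]⟩

theorem mem_projLevelStabilizer_succ {G : Subgroup (TreeAut X)} {k : ℕ} {x : X} {g : TreeAut X} :
    g ∈ projLevelStabilizer G x (k + 1) ↔ ∃ h ∈ levelStabilizer G (k + 1), sec h [x] = g := by
  constructor
  · rintro ⟨h, hh, rfl⟩
    exact ⟨h.1, hh, rfl⟩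
  · rintro ⟨h, hh, rfl⟩
    exact ⟨⟨h, levelStabilizer_succ_le G k x hh⟩, hh, rfl⟩

theorem projLevelStabilizer_succ_le {G : Subgroup (TreeAut X)} (hG : IsSelfSimilar G) (k : ℕ)
    (x : X) : projLevelStabilizer G x (k + 1) ≤ levelStabilizer G k := by
  intro g hg
  obtain ⟨h, hh, rfl⟩ := mem_projLevelStabilizer_succ.1 hg
  refine ⟨hG h hh.1 _, fun u hu => ?_⟩
  have hx : Moves h x x (sec h [x]) := ⟨(levelStabilizer_succ_le G k x hh).2, rfl⟩
  have h1 := hx.app_cons u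
  rw [hh.2 (x :: u) (by simp [hu])] at h1
  exact (List.cons.inj h1).2.symm

/-- The tuples of first-level sections of the elements of `G` that fix all letters. -/
def firstLevelSections (G : Subgroup (TreeAut X)) : Subgroup (X → TreeAut X) where
  carrier := {s | ∃ h ∈ G, ∀ y, Moves h y y (s y)}
  one_mem' := ⟨1, one_mem _, moves_one⟩
  mul_mem' := by
    rintro s t ⟨g, hg, hgs⟩ ⟨h, hh, hht⟩
    exact ⟨g * h, mul_mem hg hh, fun y => (hgs y).mul (hht y)⟩
  inv_mem' := by
    rintro s ⟨g, hg, hgs⟩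
    exact ⟨g⁻¹, inv_mem hg, fun y => (hgs y).inv⟩

/-- An element fixing all letters stabilizes level `k + 1` once its sections at all letters, not
only at `x`, stabilize level `k`. -/
theorem mem_projLevelStabilizer_of_firstLevelSections {G : Subgroup (TreeAut X)} {k : ℕ}
    {s : X → TreeAut X} (hs : s ∈ firstLevelSections G)
    (hk : ∀ y, s y ∈ levelStabilizer G k) (x : X) : s x ∈ projLevelStabilizer G x (k + 1) := by
  obtain ⟨h, hh, hhs⟩ := hs
  refine mem_projLevelStabilizer_succ.2 ⟨h, ⟨hh, ?_⟩, (hhs x).2⟩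
  rintro (_ | ⟨y, u⟩) hu
  · simp at hu
  · rw [(hhs y).app_cons, (hk y).2 u (by simpa using hu)]

/-- `h` exchanges the letters `x` and `y`, with sections `s` at `x` and `t` at `y`, and acts
trivially below the other letters. -/
def Exchanges (h : TreeAut X) (x y : X) (s t : TreeAut X) : Prop :=
  Moves h x y s ∧ Moves h y x t ∧ ∀ z, z ≠ x → z ≠ y → Moves h z z 1

/-- Conjugation moves one end of the exchange from `y` to `z`; the triviality at other letters
survives because a section `1` is conjugated to `1`. -/
theorem Exchanges.conj {h s t g r : TreeAut X} {x y z : X} (hh : Exchanges h x y s t)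
    (hx : Moves g x x 1) (hy : Moves g y z r) :
    Exchanges (g * h * g⁻¹) x z (r * s) (t * r⁻¹) := by
  refine ⟨?_, ?_, fun w hwx hwz => ?_⟩
  · simpa using (hy.mul hh.1).mul hx.inv
  · simpa using (hx.mul hh.2.1).mul hy.inv
  · obtain ⟨v, q, hv⟩ := exists_moves_to g w
    have hvx : v ≠ x := by
      rintro rfl
      exact hwx (hv.target_unique hx)
    have hvy : v ≠ y := by
      rintro rfl
      exact hwz (hv.target_unique hy)
    simpa using (hv.mul (hh.2.2 v hvx hvy)).mul hv.inv

variable [DecidableEq X]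

/-- The automorphisms `k` such that the element with section `k` at `x`, acting trivially
elsewhere, belongs to `G`. -/
def letterRist (G : Subgroup (TreeAut X)) (x : X) : Subgroup (TreeAut X) :=
  (firstLevelSections G).comap (MonoidHom.mulSingle (fun _ : X => TreeAut X) x)

theorem mem_letterRist {G : Subgroup (TreeAut X)} {x : X} {k : TreeAut X} :
    k ∈ letterRist G x ↔ Pi.mulSingle x k ∈ firstLevelSections G :=
  Iff.rfl

/-- Conjugating by `g` transports the single nontrivial section from `x` to `y` and conjugates it by
the section of `g` at `x`. -/
theorem letterRist_conj {G : Subgroup (TreeAut X)} {x y : X} {k g s : TreeAut X}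
    (hk : k ∈ letterRist G x) (hg : g ∈ G) (h : Moves g x y s) :
    s * k * s⁻¹ ∈ letterRist G y := by
  obtain ⟨f, hf, hfk⟩ := mem_letterRist.1 hk
  refine mem_letterRist.2 ⟨g * f * g⁻¹, mul_mem (mul_mem hg hf) (inv_mem hg), fun z => ?_⟩
  obtain ⟨w, t, hw⟩ := exists_moves_to g z
  have h1 := (hw.mul (hfk w)).mul hw.inv
  by_cases hz : z = y
  · subst hz
    obtain rfl := h.source_unique hw
    obtain rfl := h.sec_unique hw
    simpa using h1
  · have hwx : w ≠ x := by
      rintro rfl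
      exact hz (hw.target_unique h)
    rw [Pi.mulSingle_eq_of_ne hwx, mul_one, mul_inv_cancel] at h1
    rwa [Pi.mulSingle_eq_of_ne hz]

end RootedTree

namespace GroupGd

open RootedTree

open scoped Fin.CommRing

variable {n : ℕ}

/-! ### Wreath recursion of the generators -/

theorem gen_mem {d : ℕ} (i : Fin d) : gen i ∈ groupG d :=
  Subgroup.subset_closure ⟨i, rfl⟩

theorem isSelfSimilar_groupG (d : ℕ) : IsSelfSimilar (groupG d) := by
  refine IsSelfSimilar.of_letters fun g hg x => sec_closure_mem ?_ hg x
  rintro _ ⟨i, rfl⟩ x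
  rw [sec_gen_singleton]
  split_ifs
  · exact gen_mem _
  · exact gen_mem _
  · exact one_mem _

theorem gen_moves_self (i : Fin (n + 1)) : Moves (gen i) i (i + 1) (gen i) := by
  constructor
  · rw [app_gen_singleton, finRotate_apply, Equiv.swap_apply_left]
  · rw [sec_gen_singleton, if_pos rfl]

theorem natCast_inj {a b : ℕ} (ha : a ≤ n) (hb : b ≤ n) :
    (a : Fin (n + 1)) = b ↔ a = b := by
  rw [Fin.ext_iff, Fin.val_natCast, Fin.val_natCast, Nat.mod_eq_of_lt (by omega),
    Nat.mod_eq_of_lt (by omega)]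

theorem add_natCast_ne (p : Fin (n + 1)) {a b : ℕ} (ha : a ≤ n) (hb : b ≤ n) (hab : a ≠ b) :
    p + (a : Fin (n + 1)) ≠ p + (b : Fin (n + 1)) :=
  fun h => hab ((natCast_inj ha hb).1 (add_left_cancel h))

theorem gen_moves_succ (hn : 1 ≤ n) (i : Fin (n + 1)) :
    Moves (gen i) (i + 1) i (gen (i + 1)) := by
  have h : i + 1 ≠ i := by simpa using add_natCast_ne i hn (Nat.zero_le n) one_ne_zero
  constructor
  · rw [app_gen_singleton, finRotate_apply, Equiv.swap_apply_right]
  · rw [sec_gen_singleton, finRotate_apply, if_neg h, if_pos rfl]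

theorem gen_moves_of_ne {i x : Fin (n + 1)} (h : x ≠ i) (h' : x ≠ i + 1) :
    Moves (gen i) x x 1 := by
  constructor
  · rw [app_gen_singleton, finRotate_apply, Equiv.swap_apply_of_ne_of_ne h h']
  · rw [sec_gen_singleton, finRotate_apply, if_neg h, if_neg h']

theorem gen_exchanges (hn : 1 ≤ n) (i : Fin (n + 1)) :
    Exchanges (gen i) i (i + 1) (gen i) (gen (i + 1)) :=
  ⟨gen_moves_self i, gen_moves_succ hn i, fun _ => gen_moves_of_ne⟩

/-- On the path `i → i + 1 → i + 2` the sections `a_{i+1}⁻¹` and `a_{i+1}` cancel. This is the basic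
section-free move, by two letters. -/
theorem gen_mul_gen_inv_moves (hn : 1 ≤ n) (i : Fin (n + 1)) :
    Moves (gen (i + 1) * (gen i)⁻¹) i (i + 2) 1 := by
  have h := (gen_moves_self (i + 1)).mul (gen_moves_succ hn i).inv
  rwa [mul_inv_cancel, add_assoc, one_add_one_eq_two] at h

/-! ### Moving letters with prescribed sections, using odd `d` -/

/-- A reflexive and transitive relation on the integers modulo an odd number that relates `p` to
`p + 2` for all `p` is universal. -/
theorem rel_of_rel_add_two (hn : Even n) {r : Fin (n + 1) → Fin (n + 1) → Prop}
    (refl : ∀ p, r p p) (trans : ∀ {p q s}, r p q → r q s → r p s)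
    (step : ∀ p, r p (p + 2)) (p q : Fin (n + 1)) : r p q := by
  have h1 : ∀ (m : ℕ) (p), r p (p + m • 2) := by
    intro m
    induction m with
    | zero => intro p; simpa using refl p
    | succ m ih =>
      intro p
      rw [succ_nsmul, ← add_assoc]
      exact trans (ih p) (step _)
  have h2 : ∀ p, r p (p + 1) := by
    intro p
    obtain ⟨m, rfl⟩ := hn
    -- With `d = 2m + 1`, `m + 1` steps of length two make `d + 1`, which is `1` modulo `d`.
    have h : (m + 1) • (2 : Fin (m + m + 1)) = 1 := by
      have h3 : (m + m + 1) • (1 : Fin (m + m + 1)) = 0 := by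
        simp
      rw [← one_add_one_eq_two, nsmul_add, ← add_nsmul,
        show m + 1 + (m + 1) = (m + m + 1) + 1 by ring, succ_nsmul, h3, zero_add]
    have := h1 (m + 1) p
    rwa [h] at this
  have h3 : ∀ m : ℕ, r p (p + (m : Fin (n + 1))) := by
    intro m
    induction m with
    | zero => simpa using refl p
    | succ m ih =>
      rw [Nat.cast_succ, ← add_assoc]
      exact trans ih (h2 _)
  simpa using h3 (q - p).val

theorem exists_moves_one (hn : 1 ≤ n) (he : Even n) (p q : Fin (n + 1)) :
    ∃ g ∈ groupG (n + 1), Moves g p q 1 := by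
  refine rel_of_rel_add_two he (r := fun p q => ∃ g ∈ groupG (n + 1), Moves g p q 1)
    (fun p => ⟨1, one_mem _, moves_one p⟩) ?_ ?_ p q
  · rintro p q s ⟨g, hg, hgm⟩ ⟨h, hh, hhm⟩
    exact ⟨h * g, mul_mem hh hg, by simpa using hhm.mul hgm⟩
  · exact fun p => ⟨_, mul_mem (gen_mem _) (inv_mem (gen_mem _)), gen_mul_gen_inv_moves hn p⟩

/-- Every letter can be moved to every letter with any prescribed section in the group. -/
theorem exists_moves_of_mem (hn : 1 ≤ n) (he : Even n) {s : TreeAut (Fin (n + 1))}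
    (hs : s ∈ groupG (n + 1)) (p q : Fin (n + 1)) : ∃ g ∈ groupG (n + 1), Moves g p q s := by
  induction hs using Subgroup.closure_induction generalizing p q with
  | mem s hs =>
    obtain ⟨i, rfl⟩ := hs
    obtain ⟨g, hg, hgm⟩ := exists_moves_one hn he p i
    obtain ⟨h, hh, hhm⟩ := exists_moves_one hn he (i + 1) q
    exact ⟨h * gen i * g, mul_mem (mul_mem hh (gen_mem i)) hg, by
      simpa using (hhm.mul (gen_moves_self i)).mul hgm⟩
  | one => exact exists_moves_one hn he p q
  | mul s t _ _ ihs iht =>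
    obtain ⟨g, hg, hgm⟩ := ihs p q
    obtain ⟨h, hh, hhm⟩ := iht p p
    exact ⟨g * h, mul_mem hg hh, hgm.mul hhm⟩
  | inv s _ ih =>
    obtain ⟨g, hg, hgm⟩ := ih q p
    exact ⟨g⁻¹, inv_mem hg, hgm.inv⟩

/-! ### Elements supported below one letter -/

theorem letterRist_conj_mem (hn : 1 ≤ n) (he : Even n) {p : Fin (n + 1)}
    {k s : TreeAut (Fin (n + 1))} (hk : k ∈ letterRist (groupG (n + 1)) p)
    (hs : s ∈ groupG (n + 1)) (q : Fin (n + 1)) :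
    s * k * s⁻¹ ∈ letterRist (groupG (n + 1)) q := by
  obtain ⟨g, hg, hgm⟩ := exists_moves_of_mem hn he hs p q
  exact letterRist_conj hk hg hgm

theorem letterRist_le (hn : 1 ≤ n) (he : Even n) (p q : Fin (n + 1)) :
    letterRist (groupG (n + 1)) p ≤ letterRist (groupG (n + 1)) q :=
  fun k hk => by simpa using letterRist_conj_mem hn he hk (one_mem _) q

/-- The braid commutator of `a_i` and `a_{i+1}` acts nontrivially only below the letter `i + 1`. -/
theorem gen_mul_inv_gen_add_two_mem (hn : 2 ≤ n) (i : Fin (n + 1)) :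
    gen i * (gen (i + 2))⁻¹ ∈ letterRist (groupG (n + 1)) (i + 1) := by
  have hn1 : 1 ≤ n := by omega
  have h01 : i ≠ i + 1 := by simpa using add_natCast_ne i (Nat.zero_le n) hn1 zero_ne_one
  have h02 : i ≠ i + 2 := by simpa using add_natCast_ne i (Nat.zero_le n) hn (by norm_num)
  have h12 : i + 1 ≠ i + 2 := by simpa using add_natCast_ne i hn1 hn (by norm_num)
  have e : i + 1 + 1 = i + 2 := by rw [add_assoc, one_add_one_eq_two]
  have a0 := gen_moves_self i
  have a1 := gen_moves_succ hn1 i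
  have a2 : Moves (gen i) (i + 2) (i + 2) 1 := gen_moves_of_ne h02.symm h12.symm
  have b0 : Moves (gen (i + 1)) i i 1 := gen_moves_of_ne h01 (by rwa [e])
  have b1 := gen_moves_self (i + 1)
  have b2 := gen_moves_succ hn1 (i + 1)
  rw [e] at b1 b2
  -- Adjacent transpositions satisfy the braid relation, so this word fixes all letters; its
  -- sections are products along the path of each letter. At `i + 1` the factors `a_{i+1}` and
  -- `a_{i+1}⁻¹` cancel, leaving `a_i a_{i+2}⁻¹`.
  refine mem_letterRist.2 ⟨gen i * gen (i + 1) * gen i * (gen (i + 1))⁻¹ * (gen i)⁻¹ *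
    (gen (i + 1))⁻¹, ?_, fun y => ?_⟩
  · have := gen_mem i
    have := gen_mem (i + 1)
    exact mul_mem (mul_mem (mul_mem (mul_mem (mul_mem ‹_› ‹_›) ‹_›) (inv_mem ‹_›))
      (inv_mem ‹_›)) (inv_mem ‹_›)
  · by_cases hy0 : y = i
    · subst hy0
      rw [Pi.mulSingle_eq_of_ne h01]
      simpa [mul_assoc] using ((((a1.mul b2).mul a2).mul b2.inv).mul a1.inv).mul b0.inv
    by_cases hy1 : y = i + 1
    · subst hy1
      rw [Pi.mulSingle_eq_same]
      simpa [mul_assoc] using ((((a0.mul b0).mul a1).mul b1.inv).mul a2.inv).mul b2.inv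
    rw [Pi.mulSingle_eq_of_ne hy1]
    by_cases hy2 : y = i + 2
    · subst hy2
      simpa [mul_assoc] using ((((a2.mul b1).mul a0).mul b0.inv).mul a0.inv).mul b1.inv
    have a := gen_moves_of_ne hy0 hy1
    have b : Moves (gen (i + 1)) y y 1 := gen_moves_of_ne hy1 (by rwa [e])
    simpa using ((((a.mul b).mul a).mul b.inv).mul a.inv).mul b.inv

theorem gen_mul_inv_gen_mem (hn : 2 ≤ n) (he : Even n) (p i j : Fin (n + 1)) :
    gen i * (gen j)⁻¹ ∈ letterRist (groupG (n + 1)) p := by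
  refine rel_of_rel_add_two he
    (r := fun i j => gen i * (gen j)⁻¹ ∈ letterRist (groupG (n + 1)) p) ?_ ?_ ?_ i j
  · intro i
    simp
  · intro i j k hij hjk
    simpa using mul_mem hij hjk
  · exact fun i => letterRist_le (by omega) he _ p (gen_mul_inv_gen_add_two_mem hn i)

/-- All generators agree modulo the subgroup `letterRist`, which `G` normalizes, so the quotient is
cyclic, generated by the class of `a_i`. -/
theorem exists_eq_mul_zpow (hn : 2 ≤ n) (he : Even n) (p i : Fin (n + 1))
    {g : TreeAut (Fin (n + 1))} (hg : g ∈ groupG (n + 1)) :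
    ∃ k ∈ letterRist (groupG (n + 1)) p, ∃ m : ℤ, g = k * gen i ^ m := by
  have hn1 : 1 ≤ n := by omega
  induction hg using Subgroup.closure_induction with
  | mem g hg =>
    obtain ⟨j, rfl⟩ := hg
    exact ⟨_, gen_mul_inv_gen_mem hn he p j i, 1, by simp⟩
  | one => exact ⟨1, one_mem _, 0, by simp⟩
  | mul g h _ _ ihg ihh =>
    obtain ⟨k, hk, m, rfl⟩ := ihg
    obtain ⟨l, hl, m', rfl⟩ := ihh
    refine ⟨k * (gen i ^ m * l * (gen i ^ m)⁻¹), mul_mem hk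
      (letterRist_conj_mem hn1 he hl (zpow_mem (gen_mem i) m) p), m + m', ?_⟩
    rw [zpow_add]
    group
  | inv g _ ih =>
    obtain ⟨k, hk, m, rfl⟩ := ih
    refine ⟨gen i ^ (-m) * k⁻¹ * (gen i ^ (-m))⁻¹,
      letterRist_conj_mem hn1 he (inv_mem hk) (zpow_mem (gen_mem i) _) p, -m, ?_⟩
    group

/-! ### Exchanges the long way round the cycle -/

/-- Conjugating `a_p` by `a_{p+1}` gives distance two. The far end `q` is then pushed on by `a_{q+1}
a_q⁻¹`, which has section `1` at both `p` and `q`, so the sections of the exchange never change. -/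
theorem exists_exchanges_even (hn : 1 ≤ n) (p : Fin (n + 1)) (m : ℕ) (hm : 2 * m + 2 ≤ n) :
    ∃ h ∈ groupG (n + 1),
      Exchanges h p (p + ((2 * m + 2 : ℕ) : Fin (n + 1))) (gen (p + 1) * gen p) 1 := by
  induction m with
  | zero =>
    have h01 : p ≠ p + 1 := by simpa using add_natCast_ne p (Nat.zero_le n) hn zero_ne_one
    have h02 : p ≠ p + 1 + 1 := by
      simpa [add_assoc, one_add_one_eq_two] using
        add_natCast_ne p (Nat.zero_le n) (b := 2) (by omega) (by norm_num)
    refine ⟨_, mul_mem (mul_mem (gen_mem (p + 1)) (gen_mem p)) (inv_mem (gen_mem (p + 1))), ?_⟩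
    simpa [add_assoc, one_add_one_eq_two] using
      (gen_exchanges hn p).conj (gen_moves_of_ne h01 h02) (gen_moves_self (p + 1))
  | succ m ih =>
    obtain ⟨h, hh, hhe⟩ := ih (by omega)
    have ne : ∀ a : ℕ, 0 < a → a ≤ n → p ≠ p + (a : Fin (n + 1)) := fun a h0 ha => by
      simpa using add_natCast_ne p (Nat.zero_le n) ha h0.ne
    have e1 : p + ((2 * m + 2 : ℕ) : Fin (n + 1)) + 1 = p + ((2 * m + 3 : ℕ) : Fin (n + 1)) := by
      rw [add_assoc, ← Nat.cast_succ]
    have e2 : p + ((2 * m + 3 : ℕ) : Fin (n + 1)) + 1 =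
        p + ((2 * (m + 1) + 2 : ℕ) : Fin (n + 1)) := by
      rw [add_assoc, ← Nat.cast_succ]
      rfl
    have h2 := ne (2 * m + 2) (by omega) (by omega)
    have h3 := ne (2 * m + 3) (by omega) (by omega)
    have h4 := ne (2 * (m + 1) + 2) (by omega) (by omega)
    generalize p + ((2 * m + 2 : ℕ) : Fin (n + 1)) = q at *
    generalize p + ((2 * (m + 1) + 2 : ℕ) : Fin (n + 1)) = t at *
    rw [← e1] at h3 e2
    rw [← e2] at h4 ⊢
    have hp : Moves (gen (q + 1) * (gen q)⁻¹) p p 1 := by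
      simpa using (gen_moves_of_ne h3 h4).mul (gen_moves_of_ne h2 h3).inv
    have hq := gen_mul_gen_inv_moves hn q
    rw [← one_add_one_eq_two, ← add_assoc] at hq
    refine ⟨_, mul_mem (mul_mem (mul_mem (gen_mem (q + 1)) (inv_mem (gen_mem q))) hh)
      (inv_mem (mul_mem (gen_mem (q + 1)) (inv_mem (gen_mem q)))), ?_⟩
    simpa only [one_mul, inv_one, mul_one] using hhe.conj hp hq

theorem exists_exchanges_add (hn : 2 ≤ n) (he : Even n) (p : Fin (n + 1)) :
    ∃ h ∈ groupG (n + 1),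
      Exchanges h (p + 1) p (gen (p + 1 + 1) * gen (p + 1)) 1 := by
  obtain ⟨m, hm⟩ := he
  -- Here `2 * (m - 1) + 2 = n = d - 1`, so the far end of the exchange starting at `p + 1` is `p +
  -- 1 + n = p`.
  obtain ⟨h, hh, hhe⟩ := exists_exchanges_even (by omega) (p + 1) (m - 1) (by omega)
  have e : p + 1 + ((2 * (m - 1) + 2 : ℕ) : Fin (n + 1)) = p := by
    rw [show 2 * (m - 1) + 2 = n by omega, add_assoc, add_comm 1, ← Nat.cast_succ]
    simp
  rw [e] at hhe
  exact ⟨h, hh, hhe⟩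

/-! ### Pairs of inverse sections and the conclusion -/

/-- The group contains an element that fixes all letters and has sections `a_{p+2}` at `p`,
`a_p⁻¹` at `p + 1`, and trivial sections elsewhere. -/
theorem mulSingle_gen_mul_mem (hn : 2 ≤ n) (he : Even n) (p : Fin (n + 1)) :
    Pi.mulSingle p (gen (p + 2)) * Pi.mulSingle (p + 1) (gen p)⁻¹ ∈
      firstLevelSections (groupG (n + 1)) := by
  have hn1 : 1 ≤ n := by omega
  obtain ⟨h, hh, h1, h0, hy⟩ := exists_exchanges_add hn he p
  have hp : p ≠ p + 1 := by simpa using add_natCast_ne p (Nat.zero_le n) hn1 zero_ne_one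
  obtain ⟨g0, g1, gy⟩ := gen_exchanges hn1 p
  refine ⟨h * (gen p)⁻¹, mul_mem hh (inv_mem (gen_mem p)), fun y => ?_⟩
  rw [Pi.mul_apply]
  by_cases hyp : y = p
  · subst hyp
    simpa [Pi.mulSingle_eq_of_ne hp, add_assoc, one_add_one_eq_two] using h1.mul g1.inv
  by_cases hyp1 : y = p + 1
  · subst hyp1
    simpa [Pi.mulSingle_eq_of_ne hp.symm] using h0.mul g0.inv
  · simpa [Pi.mulSingle_eq_of_ne hyp, Pi.mulSingle_eq_of_ne hyp1] using
      (hy y hyp1 hyp).mul (gy y hyp hyp1).inv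

theorem mulSingle_mul_mulSingle_inv_mem (hn : 2 ≤ n) (he : Even n) (p : Fin (n + 1))
    {g : TreeAut (Fin (n + 1))} (hg : g ∈ groupG (n + 1)) :
    Pi.mulSingle p g * Pi.mulSingle (p + 1) g⁻¹ ∈ firstLevelSections (groupG (n + 1)) := by
  have hp : p ≠ p + 1 := by
    simpa using add_natCast_ne p (Nat.zero_le n) (b := 1) (by omega) zero_ne_one
  have hcomm (u v : TreeAut (Fin (n + 1))) :
      Commute (Pi.mulSingle p u : Fin (n + 1) → TreeAut (Fin (n + 1)))
        (Pi.mulSingle (p + 1) v) :=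
    Pi.mulSingle_commute (f := fun _ : Fin (n + 1) => TreeAut (Fin (n + 1))) hp u v
  have ha : Pi.mulSingle p (gen p) * Pi.mulSingle (p + 1) (gen p)⁻¹ ∈
      firstLevelSections (groupG (n + 1)) := by
    -- Multiplying by `a_p a_{p+2}⁻¹` at `p` corrects the section `a_{p+2}` to `a_p`.
    have h := mul_mem (mem_letterRist.1 (gen_mul_inv_gen_mem hn he p p (p + 2)))
      (mulSingle_gen_mul_mem hn he p)
    rwa [← mul_assoc, ← Pi.mulSingle_mul, inv_mul_cancel_right] at h
  obtain ⟨k, hk, m, rfl⟩ := exists_eq_mul_zpow hn he p p hg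
  have hk' := letterRist_le (by omega) he p (p + 1) (inv_mem hk)
  -- For `g = k a_p ^ m`, written at the letters `p`, `p + 1`: `(k, 1) (a_p, a_p⁻¹)^m (1, k⁻¹) = (g,
  -- g⁻¹)`.
  have h := mul_mem (mul_mem (mem_letterRist.1 hk) (zpow_mem ha m)) (mem_letterRist.1 hk')
  rw [(hcomm _ _).mul_zpow, ← Pi.mulSingle_zpow, ← Pi.mulSingle_zpow, ← mul_assoc,
    ← Pi.mulSingle_mul, mul_assoc, ← Pi.mulSingle_mul] at h
  rwa [mul_inv_rev, ← inv_zpow]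

theorem projLevelStabilizer_groupG (hn : 2 ≤ n) (he : Even n) (k : ℕ) (x : Fin (n + 1)) :
    projLevelStabilizer (groupG (n + 1)) x (k + 1) = levelStabilizer (groupG (n + 1)) k := by
  refine le_antisymm (projLevelStabilizer_succ_le (isSelfSimilar_groupG _) k x) fun g hg => ?_
  have hx : x ≠ x + 1 := by
    simpa using add_natCast_ne x (Nat.zero_le n) (b := 1) (by omega) zero_ne_one
  have h := mem_projLevelStabilizer_of_firstLevelSections (k := k)
    (mulSingle_mul_mulSingle_inv_mem hn he x hg.1) (fun y => ?_) x
  · simpa [Pi.mulSingle_eq_of_ne hx] using h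
  · rw [Pi.mul_apply, Pi.mulSingle_apply, Pi.mulSingle_apply]
    refine mul_mem ?_ ?_
    · split_ifs
      · exact hg
      · exact one_mem _
    · split_ifs
      · exact inv_mem hg
      · exact one_mem _

end GroupGd

theorem mainTheorem9 (d : ℕ) (hd : 3 ≤ d) (hodd : Odd d) :
    (∀ (k : ℕ) (x : Fin d),
      RootedTree.projLevelStabilizer (GroupGd.groupG d) x (k + 1) =
        RootedTree.levelStabilizer (GroupGd.groupG d) k) ∧
    RootedTree.IsVeryStronglyFractal (GroupGd.groupG d) := by
  obtain ⟨n, rfl⟩ : ∃ n, d = n + 1 := ⟨d - 1, by omega⟩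
  have hn : 2 ≤ n := by omega
  have he : Even n := by
    rw [← Nat.not_odd_iff_even]
    exact fun h => Nat.not_even_iff_odd.2 hodd h.add_one
  have h := GroupGd.projLevelStabilizer_groupG hn he
  exact ⟨h, GroupGd.isSelfSimilar_groupG _, RootedTree.IsLevelTransitive.of_letters
    fun x y _ hs => GroupGd.exists_moves_of_mem (by omega) he hs x y, h⟩
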